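/- Let $\mathcal L$ be a (possibly many-sorted) language of continuous logic: each sort has a symbol for a metric with a prescribed bound, function and relation symbols have prescribed uniform continuity moduli, each relation symbol takes its values in a prescribed compact interval, the connectives are all uniformly continuous functions $\mathbb R^n\to\mathbb R$, and the quantifiers are $\inf$ and $\sup$ over a sort. Let $M$ be a metric $\mathcal L$-structure (with nonempty sorts) and let $x$ be a single variable. Write $M_x$ for the sort of $M$ over which $x$ ranges. Let $\mathcal P^x_M$ be the Banach algebra of unary definable predicates over $M$, that is, of the uniform limits on $M_x$ of the functions $a\mapsto\varphi^M(a)$, where $\varphi(x)$ runs through the $\mathcal L$-formulas with parameters in $M$ and no free variable other than $x$; its norm is $\|P\|=\sup_{a\in M_x}|P(a)|$. Give the dual $(\mathcal P^x_M)'$ the weak$^*$ topology. A \emph{mean} over $M$ is a functional $\mathfrak m\in(\mathcal P^x_M)'$ such that $\mathfrak m(P)\ge 0$ whenever $P\ge 0$, and $\mathfrak m(\mathbf 1)=1$. Let $\Sigma(M)\subseteq(\mathcal P^x_M)'$ be the set of all means over $M$. A \emph{complete type} over $M$ in the variable $x$ is identified with the functional $P\mapsto P^N(a)$ on $\mathcal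 P^x_M$, where $N$ is an elementary extension of $M$ and $a\in N_x$ realizes the type. (Here $P^N$ is the canonical extension of $P$ to $N$: if $P=\lim_n\varphi_n^M$ uniformly, then $P^N=\lim_n\varphi_n^N$.) Let $S_M(x)\subseteq(\mathcal P^x_M)'$ be the set of all complete types over $M$. Then: 1. $\Sigma(M)$ is the weak$^*$ closure of the convex hull of $S_M(x)$. 2. The extreme points of $\Sigma(M)$ are exactly the complete types: $\operatorname{ext}\Sigma(M)=S_M(x)$. 3. The complete types are exactly the multiplicative means: $S_M(x)=\{\mathfrak m\in\Sigma(M) : \mathfrak m(PQ)=\mathfrak m(P)\,\mathfrak m(Q)\text{ for all }P,Q\in\mathcal P^x_M\}$. -/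

import Mathlib

universe u v w z

open Set BoundedContinuousFunction

noncomputable section

/-- A many-sorted language of continuous logic. Every sort carries a bound for its metric, every
function and relation symbol carries uniform continuity moduli, and every relation symbol `R`
carries the compact interval `[lo R, hi R]` in which it takes its values. -/
structure MetricLanguage where
  Srt : Type u
  diam : Srt → ℝ
  diam_pos : ∀ s, 0 < diam s
  Fn : Type v
  fnArity : Fn → ℕ
  fnDom : ∀ f, Fin (fnArity f) → Srt
  fnRng : Fn → Srt
  fnModulus : ∀ f, Fin (fnArity f) → ℝ → ℝ
  fnModulus_pos : ∀ f i ε, 0 < ε → 0 < fnModulus f i ε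
  Rel : Type w
  relArity : Rel → ℕ
  relDom : ∀ R, Fin (relArity R) → Srt
  lo : Rel → ℝ
  hi : Rel → ℝ
  relModulus : ∀ R, Fin (relArity R) → ℝ → ℝ
  relModulus_pos : ∀ R i ε, 0 < ε → 0 < relModulus R i ε

namespace MetricLanguage

variable (L : MetricLanguage.{u, v, w})

/-- The variables: infinitely many in each sort. `x.1` is the sort of the variable `x`. -/
abbrev Var : Type u := L.Srt × ℕ

/-- Terms in the language `L(A)`, that is, `L` with a new constant for each element of `A`. -/
inductive Term (A : L.Srt → Type z) : L.Srt → Type (max u v z)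
  | var (x : L.Var) : Term A x.1
  | param {s : L.Srt} (a : A s) : Term A s
  | app (f : L.Fn) (ts : ∀ i, Term A (L.fnDom f i)) : Term A (L.fnRng f)

/-- Formulas in the language `L(A)`. Connectives are all uniformly continuous functions
`ℝ ^ n → ℝ`, quantifiers are `inf` and `sup` over a sort. -/
inductive Formula (A : L.Srt → Type z) : Type (max u v w z)
  | dist {s : L.Srt} (t₁ t₂ : L.Term A s) : Formula A
  | rel (R : L.Rel) (ts : ∀ i, L.Term A (L.relDom R i)) : Formula A
  | conn {n : ℕ} (f : (Fin n → ℝ) → ℝ) (hf : UniformContinuous f)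
      (φs : Fin n → Formula A) : Formula A
  | inf (y : L.Var) (φ : Formula A) : Formula A
  | sup (y : L.Var) (φ : Formula A) : Formula A

variable {L} {A : L.Srt → Type z}

/-- The variables that occur in a term. -/
def Term.vars : ∀ {s : L.Srt}, L.Term A s → Set L.Var
  | _, .var x => {x}
  | _, .param _ => ∅
  | _, .app _ ts => ⋃ i, (ts i).vars

/-- The free variables of a formula. -/
def Formula.freeVars : L.Formula A → Set L.Var
  | .dist t₁ t₂ => t₁.vars ∪ t₂.vars
  | .rel _ ts => ⋃ i, (ts i).vars
  | .conn _ _ φs => ⋃ i, (φs i).freeVars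
  | .inf y φ => φ.freeVars \ {y}
  | .sup y φ => φ.freeVars \ {y}

end MetricLanguage

/-- A metric structure for `L`: a nonempty metric space of diameter at most `L.diam s` for each sort
`s`, with functions and relations that respect the moduli and ranges given by the language. -/
structure MetricStructure (L : MetricLanguage.{u, v, w}) where
  carrier : L.Srt → Type z
  [metric : ∀ s, MetricSpace (carrier s)]
  [nonempty : ∀ s, Nonempty (carrier s)]
  dist_le : ∀ (s : L.Srt) (a b : carrier s), dist a b ≤ L.diam s
  fn : ∀ f : L.Fn, (∀ i, carrier (L.fnDom f i)) → carrier (L.fnRng f)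
  fn_modulus : ∀ (f : L.Fn) (ε : ℝ), 0 < ε → ∀ a b : ∀ i, carrier (L.fnDom f i),
    (∀ i, dist (a i) (b i) < L.fnModulus f i ε) → dist (fn f a) (fn f b) ≤ ε
  rel : ∀ R : L.Rel, (∀ i, carrier (L.relDom R i)) → ℝ
  rel_mem : ∀ R a, rel R a ∈ Icc (L.lo R) (L.hi R)
  rel_modulus : ∀ (R : L.Rel) (ε : ℝ), 0 < ε → ∀ a b : ∀ i, carrier (L.relDom R i),
    (∀ i, dist (a i) (b i) < L.relModulus R i ε) → dist (rel R a) (rel R b) ≤ ε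

attribute [instance] MetricStructure.metric MetricStructure.nonempty

namespace MetricStructure

open MetricLanguage Classical

variable {L : MetricLanguage.{u, v, w}} {A : L.Srt → Type z}

/-- Assignments of elements of the structure `N` to the variables. -/
abbrev Assignment (N : MetricStructure.{u, v, w, z} L) : Type (max u z) := ∀ y : L.Var, N.carrier y.1

/-- The value of a term in `N`, where `ρ` interprets the constants for the elements of `A`. -/
def termVal (N : MetricStructure.{u, v, w, z} L) (ρ : ∀ s, A s → N.carrier s) (α : N.Assignment) :
    ∀ {s : L.Srt}, L.Term A s → N.carrier s
  | _, .var y => α y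
  | _, .param a => ρ _ a
  | _, .app f ts => N.fn f fun i => N.termVal ρ α (ts i)

/-- The value of a formula in `N`, where `ρ` interprets the constants for the elements of `A`. -/
def eval (N : MetricStructure.{u, v, w, z} L) (ρ : ∀ s, A s → N.carrier s) :
    N.Assignment → L.Formula A → ℝ
  | α, .dist t₁ t₂ => Dist.dist (N.termVal ρ α t₁) (N.termVal ρ α t₂)
  | α, .rel R ts => N.rel R fun i => N.termVal ρ α (ts i)
  | α, .conn f _ φs => f fun i => N.eval ρ α (φs i)
  | α, .inf y φ => ⨅ b : N.carrier y.1, N.eval ρ (Function.update α y b) φ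
  | α, .sup y φ => ⨆ b : N.carrier y.1, N.eval ρ (Function.update α y b) φ

theorem exists_bound (N : MetricStructure.{u, v, w, z} L) (ρ : ∀ s, A s → N.carrier s)
    (φ : L.Formula A) : ∃ C, ∀ α, |N.eval ρ α φ| ≤ C := by
  induction φ with
  | @dist s t₁ t₂ =>
    refine ⟨L.diam s, fun α => ?_⟩
    simp only [eval, abs_of_nonneg dist_nonneg]
    exact N.dist_le _ _ _
  | rel R ts =>
    refine ⟨max |L.lo R| |L.hi R|, fun α => ?_⟩
    have h := N.rel_mem R fun i => N.termVal ρ α (ts i)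
    exact abs_le_max_abs_abs h.1 h.2
  | @conn n f hf φs ih =>
    choose C hC using ih
    obtain ⟨B, hB⟩ := (isCompact_univ_pi fun i => isCompact_Icc (a := -C i) (b := C i)).exists_bound_of_continuousOn
      hf.continuous.continuousOn
    exact ⟨B, fun α => hB _ fun i _ => abs_le.1 (hC i α)⟩
  | inf y φ ih =>
    obtain ⟨C, hC⟩ := ih
    refine ⟨C, fun α => abs_le.2 ⟨le_ciInf fun b => (abs_le.1 (hC _)).1, ?_⟩⟩
    obtain ⟨b⟩ := N.nonempty y.1
    exact (ciInf_le ⟨-C, by rintro _ ⟨b, rfl⟩; exact (abs_le.1 (hC _)).1⟩ b).trans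
      (abs_le.1 (hC _)).2
  | sup y φ ih =>
    obtain ⟨C, hC⟩ := ih
    refine ⟨C, fun α => abs_le.2 ⟨?_, ciSup_le fun b => (abs_le.1 (hC _)).2⟩⟩
    obtain ⟨b⟩ := N.nonempty y.1
    exact (abs_le.1 (hC (Function.update α y b))).1.trans
      (le_ciSup (f := fun b => N.eval ρ (Function.update α y b) φ)
        ⟨C, by rintro _ ⟨b, rfl⟩; exact (abs_le.1 (hC _)).2⟩ b)

theorem termVal_unif (N : MetricStructure.{u, v, w, z} L) (ρ : ∀ s, A s → N.carrier s)
    {s : L.Srt} (t : L.Term A s) (ε : ℝ) (hε : 0 < ε) :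
    ∃ δ > 0, ∀ α β : N.Assignment, (∀ y, dist (α y) (β y) < δ) →
      dist (N.termVal ρ α t) (N.termVal ρ β t) < ε := by
  induction t generalizing ε with
  | var y => exact ⟨ε, hε, fun α β h => h y⟩
  | param a => exact ⟨1, one_pos, fun α β _ => by simpa [termVal] using hε⟩
  | app f ts ih =>
    choose δ hδ h using fun i => ih i (L.fnModulus f i (ε / 2))
      (L.fnModulus_pos f i _ (half_pos hε))
    obtain ⟨η, hη, hle⟩ : ∃ η > 0, ∀ i, η ≤ δ i := by
      rcases isEmpty_or_nonempty (Fin (L.fnArity f)) with he | he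
      · exact ⟨1, one_pos, fun i => he.elim i⟩
      · obtain ⟨i, hi⟩ := Finite.exists_min δ
        exact ⟨δ i, hδ i, hi⟩
    refine ⟨η, hη, fun α β hαβ => ?_⟩
    refine (N.fn_modulus f (ε / 2) (half_pos hε) _ _ fun i => ?_).trans_lt (half_lt_self hε)
    exact h i α β fun y => (hαβ y).trans_le (hle i)

theorem eval_unif (N : MetricStructure.{u, v, w, z} L) (ρ : ∀ s, A s → N.carrier s)
    (φ : L.Formula A) (ε : ℝ) (hε : 0 < ε) :
    ∃ δ > 0, ∀ α β : N.Assignment, (∀ y, dist (α y) (β y) < δ) →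
      dist (N.eval ρ α φ) (N.eval ρ β φ) < ε := by
  induction φ generalizing ε with
  | dist t₁ t₂ =>
    obtain ⟨δ₁, h₁, H₁⟩ := N.termVal_unif ρ t₁ (ε / 2) (half_pos hε)
    obtain ⟨δ₂, h₂, H₂⟩ := N.termVal_unif ρ t₂ (ε / 2) (half_pos hε)
    refine ⟨min δ₁ δ₂, lt_min h₁ h₂, fun α β h => ?_⟩
    refine (dist_dist_dist_le _ _ _ _).trans_lt ?_
    have a := H₁ α β fun y => (h y).trans_le (min_le_left _ _)
    have b := H₂ α β fun y => (h y).trans_le (min_le_right _ _)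
    linarith
  | rel R ts =>
    choose δ hδ h using fun i => N.termVal_unif ρ (ts i) (L.relModulus R i (ε / 2))
      (L.relModulus_pos R i _ (half_pos hε))
    obtain ⟨η, hη, hle⟩ : ∃ η > 0, ∀ i, η ≤ δ i := by
      rcases isEmpty_or_nonempty (Fin (L.relArity R)) with he | he
      · exact ⟨1, one_pos, fun i => he.elim i⟩
      · obtain ⟨i, hi⟩ := Finite.exists_min δ
        exact ⟨δ i, hδ i, hi⟩
    refine ⟨η, hη, fun α β hαβ => ?_⟩
    refine (N.rel_modulus R (ε / 2) (half_pos hε) _ _ fun i => ?_).trans_lt (half_lt_self hε)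
    exact h i α β fun y => (hαβ y).trans_le (hle i)
  | @conn n f hf φs ih =>
    obtain ⟨η, hη, H⟩ := Metric.uniformContinuous_iff.1 hf ε hε
    choose δ hδ h using fun i => ih i η hη
    obtain ⟨κ, hκ, hle⟩ : ∃ κ > 0, ∀ i, κ ≤ δ i := by
      rcases isEmpty_or_nonempty (Fin n) with he | he
      · exact ⟨1, one_pos, fun i => he.elim i⟩
      · obtain ⟨i, hi⟩ := Finite.exists_min δ
        exact ⟨δ i, hδ i, hi⟩
    refine ⟨κ, hκ, fun α β hαβ => H ((dist_pi_lt_iff hη).2 fun i => ?_)⟩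
    exact h i α β fun y => (hαβ y).trans_le (hle i)
  | inf y φ ih =>
    obtain ⟨δ, hδ, h⟩ := ih (ε / 2) (half_pos hε)
    obtain ⟨C, hC⟩ := N.exists_bound ρ φ
    have key : ∀ α β : N.Assignment, (∀ y, dist (α y) (β y) < δ) →
        N.eval ρ α (.inf y φ) ≤ N.eval ρ β (.inf y φ) + ε / 2 := by
      intro α β hαβ
      rw [← sub_le_iff_le_add]
      refine le_ciInf fun b => ?_
      have h1 : N.eval ρ α (.inf y φ) ≤ N.eval ρ (Function.update α y b) φ :=
        ciInf_le ⟨-C, by rintro _ ⟨b, rfl⟩; exact (abs_le.1 (hC _)).1⟩ b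
      have h2 := h (Function.update α y b) (Function.update β y b) fun y' => by
        by_cases hy : y' = y
        · subst hy; simpa using hδ
        · simpa [Function.update_of_ne hy] using hαβ y'
      rw [Real.dist_eq, abs_lt] at h2
      linarith
    refine ⟨δ, hδ, fun α β hαβ => ?_⟩
    have h1 := key α β hαβ
    have h2 := key β α fun y => by rw [dist_comm]; exact hαβ y
    rw [Real.dist_eq, abs_lt]
    constructor <;> linarith
  | sup y φ ih =>
    obtain ⟨δ, hδ, h⟩ := ih (ε / 2) (half_pos hε)
    obtain ⟨C, hC⟩ := N.exists_bound ρ φ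
    have key : ∀ α β : N.Assignment, (∀ y, dist (α y) (β y) < δ) →
        N.eval ρ α (.sup y φ) ≤ N.eval ρ β (.sup y φ) + ε / 2 := by
      intro α β hαβ
      refine ciSup_le fun b => ?_
      have h1 : N.eval ρ (Function.update β y b) φ ≤ N.eval ρ β (.sup y φ) :=
        le_ciSup (f := fun b => N.eval ρ (Function.update β y b) φ)
          ⟨C, by rintro _ ⟨b, rfl⟩; exact (abs_le.1 (hC _)).2⟩ b
      have h2 := h (Function.update α y b) (Function.update β y b) fun y' => by
        by_cases hy : y' = y
        · subst hy; simpa using hδ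
        · simpa [Function.update_of_ne hy] using hαβ y'
      rw [Real.dist_eq, abs_lt] at h2
      linarith
    refine ⟨δ, hδ, fun α β hαβ => ?_⟩
    have h1 := key α β hαβ
    have h2 := key β α fun y => by rw [dist_comm]; exact hαβ y
    rw [Real.dist_eq, abs_lt]
    constructor <;> linarith

/-- `φ^N(a)`, where `a` is put for the variable `x`. It is used for formulas `φ` in which at most `x`
is free, so the values given to the other variables do not matter. -/
def evalAt (N : MetricStructure.{u, v, w, z} L) (ρ : ∀ s, A s → N.carrier s) (x : L.Var)
    (φ : L.Formula A) (a : N.carrier x.1) : ℝ :=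
  N.eval ρ (Function.update (fun _ => Classical.arbitrary _) x a) φ

/-- A formula over `M` in the variable `x`, as a bounded continuous function on `M`. -/
def interp (M : MetricStructure.{u, v, w, z} L) (x : L.Var) (φ : L.Formula M.carrier) :
    M.carrier x.1 →ᵇ ℝ :=
  BoundedContinuousFunction.ofNormedAddCommGroup (M.evalAt (fun _ a => a) x φ)
    (by
      refine Metric.continuous_iff.2 fun b ε hε => ?_
      obtain ⟨δ, hδ, h⟩ := M.eval_unif (fun _ a => a) φ ε hε
      refine ⟨δ, hδ, fun a hab => h _ _ fun y => ?_⟩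
      by_cases hy : y = x
      · subst hy; simpa using hab
      · simpa [Function.update_of_ne hy] using hδ)
    (M.exists_bound (fun _ a => a) φ).choose
    (fun _ => (M.exists_bound (fun _ a => a) φ).choose_spec _)

@[simp] theorem interp_apply (M : MetricStructure.{u, v, w, z} L) (x : L.Var)
    (φ : L.Formula M.carrier) (a : M.carrier x.1) :
    M.interp x φ a = M.evalAt (fun _ a => a) x φ a := rfl

/-- The functions on `M` given by the formulas over `M` in which at most `x` is free; they are an
algebra. -/
def formulaAlgebra (M : MetricStructure.{u, v, w, z} L) (x : L.Var) :
    Subalgebra ℝ (M.carrier x.1 →ᵇ ℝ) where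
  carrier := {g | ∃ φ : L.Formula M.carrier, φ.freeVars ⊆ {x} ∧ M.interp x φ = g}
  algebraMap_mem' r := by
    refine ⟨.conn (n := 0) (fun _ => r) uniformContinuous_const Fin.elim0, ?_, ?_⟩
    · simp [Formula.freeVars]
    · ext a; simp [evalAt, eval]
  add_mem' := by
    rintro _ _ ⟨φ, hφ, rfl⟩ ⟨ψ, hψ, rfl⟩
    refine ⟨.conn (n := 2) (fun y => y 0 + y 1)
      ((Pi.uniformContinuous_proj _ 0).add (Pi.uniformContinuous_proj _ 1)) ![φ, ψ], ?_, ?_⟩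
    · refine iUnion_subset fun i => ?_
      fin_cases i
      exacts [hφ, hψ]
    · ext a; simp [evalAt, eval]
  mul_mem' := by
    rintro _ _ ⟨φ, hφ, rfl⟩ ⟨ψ, hψ, rfl⟩
    obtain ⟨B, hB⟩ := M.exists_bound (fun _ a => a) φ
    obtain ⟨C, hC⟩ := M.exists_bound (fun _ a => a) ψ
    have hle : -max B C ≤ max B C := by
      have := (abs_nonneg _).trans (hB fun _ => Classical.arbitrary _)
      have := le_max_left B C
      linarith
    let K := Icc (-max B C) (max B C)
    have hmul : UniformContinuous fun q : K × K => (q.1 : ℝ) * q.2 :=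
      CompactSpace.uniformContinuous_of_continuous (by fun_prop)
    have hpr := (LipschitzWith.projIcc hle).uniformContinuous
    refine ⟨.conn (n := 2)
      (fun y => (projIcc (-max B C) (max B C) hle (y 0) : ℝ) * projIcc (-max B C) (max B C) hle (y 1))
      (hmul.comp ((hpr.comp (Pi.uniformContinuous_proj _ 0)).prodMk
        (hpr.comp (Pi.uniformContinuous_proj _ 1)))) ![φ, ψ], ?_, ?_⟩
    · refine iUnion_subset fun i => ?_
      fin_cases i
      exacts [hφ, hψ]
    · ext a
      have h1 := abs_le.1 ((hB (Function.update (fun _ => Classical.arbitrary _) x a)).trans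
        (le_max_left B C))
      have h2 := abs_le.1 ((hC (Function.update (fun _ => Classical.arbitrary _) x a)).trans
        (le_max_right B C))
      simp [evalAt, eval, projIcc_of_mem hle (mem_Icc.2 h1), projIcc_of_mem hle (mem_Icc.2 h2)]

/-- The definable predicates over `M` in the variable `x`: the uniform limits of formulas over `M`,
with the norm `sup {|P(a)| : a ∈ M}`. This is a Banach algebra. -/
def definablePredicates (M : MetricStructure.{u, v, w, z} L) (x : L.Var) :
    Subalgebra ℝ (M.carrier x.1 →ᵇ ℝ) :=
  (M.formulaAlgebra x).topologicalClosure

/-- A formula over `M` in which at most `x` is free, as a definable predicate. -/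
def toPredicate (M : MetricStructure.{u, v, w, z} L) (x : L.Var) (φ : L.Formula M.carrier)
    (hφ : φ.freeVars ⊆ {x}) : M.definablePredicates x :=
  ⟨M.interp x φ, (M.formulaAlgebra x).le_topologicalClosure ⟨φ, hφ, rfl⟩⟩

/-- The theory of `M` with a constant for each of its elements: the sentences over `M` whose value
in `M` is `0`. -/
def theoryOver (M : MetricStructure.{u, v, w, z} L) : Set (L.Formula M.carrier) :=
  {σ | σ.freeVars = ∅ ∧ ∀ α, M.eval (fun _ a => a) α σ = 0}

/-- `N`, with `ρ` interpreting the constants for the elements of `M`, is a model of the theory of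
`M` over `M`; equivalently `ρ : M → N` is an elementary embedding. -/
def IsModelOver (M N : MetricStructure.{u, v, w, z} L) (ρ : ∀ s, M.carrier s → N.carrier s) : Prop :=
  ∀ σ ∈ M.theoryOver, ∀ α, N.eval ρ α σ = 0

/-- `e` is the functional `P ↦ P^N(a)` on definable predicates over `M`. (Formulas are dense among
the definable predicates, so `e` is determined by its values on formulas.) -/
def IsEvaluation (M N : MetricStructure.{u, v, w, z} L) (ρ : ∀ s, M.carrier s → N.carrier s)
    (x : L.Var) (a : N.carrier x.1) (e : WeakDual ℝ (M.definablePredicates x)) : Prop :=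
  ∀ (φ : L.Formula M.carrier) (hφ : φ.freeVars ⊆ {x}), e (M.toPredicate x φ hφ) = N.evalAt ρ x φ a

/-- The space `S_M(x)` of complete types over `M`, as a subspace of the dual of the space of definable
predicates with the weak-* topology. The type of an element `a` of a model `N` of the theory of `M`
over `M` is the functional `P ↦ P^N(a)`. -/
def typeSpace (M : MetricStructure.{u, v, w, z} L) (x : L.Var) :
    Set (WeakDual ℝ (M.definablePredicates x)) :=
  {e | ∃ (N : MetricStructure.{u, v, w, z} L) (ρ : ∀ s, M.carrier s → N.carrier s),
    M.IsModelOver N ρ ∧ ∃ a : N.carrier x.1, M.IsEvaluation N ρ x a e}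

/-- A partial type over `M`: a set of definable predicates over `M` with a common zero in a model
of the theory of `M` over `M`. -/
def IsPartialType (M : MetricStructure.{u, v, w, z} L) (x : L.Var)
    (π : Set (M.definablePredicates x)) : Prop :=
  ∃ (N : MetricStructure.{u, v, w, z} L) (ρ : ∀ s, M.carrier s → N.carrier s),
    M.IsModelOver N ρ ∧ ∃ (a : N.carrier x.1) (e : WeakDual ℝ (M.definablePredicates x)),
      M.IsEvaluation N ρ x a e ∧ ∀ P ∈ π, e P = 0

/-- The maximal partial types are exactly the kernels of the elements of `M.typeSpace x`. -/
theorem maximal_isPartialType_iff (M : MetricStructure.{u, v, w, z} L) (x : L.Var)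
    (p : Set (M.definablePredicates x)) :
    Maximal (M.IsPartialType x) p ↔ ∃ e ∈ M.typeSpace x, p = {P | e P = 0} := by
  have hone : ∀ e ∈ M.typeSpace x, e 1 = 1 := by
    rintro e ⟨N, ρ, -, a, he⟩
    have h0 : (.conn (n := 0) (fun _ => 1) uniformContinuous_const Fin.elim0 :
      L.Formula M.carrier).freeVars ⊆ {x} := by simp [Formula.freeVars]
    have h := he _ h0
    have h1 : M.toPredicate x _ h0 = 1 := by
      apply Subtype.ext; ext a; simp [toPredicate, evalAt, eval]
    rw [h1] at h
    simpa [evalAt, eval] using h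
  constructor
  · rintro ⟨⟨N, ρ, hN, a, e, he, hp⟩, hmax⟩
    exact ⟨e, ⟨N, ρ, hN, a, he⟩, Subset.antisymm hp
      (hmax ⟨N, ρ, hN, a, e, he, fun _ h => h⟩ hp)⟩
  · rintro ⟨e, he, rfl⟩
    obtain ⟨N, ρ, hN, a, hae⟩ := id he
    refine ⟨⟨N, ρ, hN, a, e, hae, fun _ h => h⟩, ?_⟩
    rintro q ⟨N', ρ', hN', a', e', he', hq⟩ hle P hP
    have h1 : e (P - e P • 1) = 0 := by
      rw [map_sub e, map_smul e, hone e he]; simp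
    have h2 := hq _ (hle h1)
    rw [map_sub e', map_smul e', hq P hP, hone e' ⟨N', ρ', hN', a', he'⟩] at h2
    simpa using h2

/-- The space `Σ(M)` of means over `M`: the positive functionals on the space of definable predicates
that take the value `1` at the constant function `1`. (Positivity and the value at `1` force
`|m P| ≤ ‖P‖`, so asking for continuity excludes nothing.) -/
def meanSpace (M : MetricStructure.{u, v, w, z} L) (x : L.Var) :
    Set (WeakDual ℝ (M.definablePredicates x)) :=
  {m | (∀ P : M.definablePredicates x, (∀ a, 0 ≤ (P : M.carrier x.1 →ᵇ ℝ) a) → 0 ≤ m P) ∧ m 1 = 1}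

end MetricStructure

end

/-! Everything reduces to identifying both the types and the extreme means with the multiplicative
means.

A type is multiplicative because one formula, multiplication truncated to a bounded interval,
defines the product in both `M` and `N`; it is positive because lower bounds of formulas pass to
elementary extensions (`IsModelOver.le_evalAt`). Conversely, for a multiplicative mean `m` every
predicate `P` has variance `m (P * P) - m P ^ 2 = 0`. Hence `m` is a limit of point evaluations
along an ultrafilter on `M_x` (`exists_ultrafilter_of_map_mul`), and by Łoś's theorem the class of
the identity family in the corresponding ultrapower realizes `m`.

Zero variance also makes `m` extreme, since the variance about `m P` splits over any convex
decomposition. An extreme mean is multiplicative because otherwise reweighting it by the densities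
`1 + R` and `1 - R` would decompose it. The closure statement is then Krein–Milman, as the means
form a weak-* compact convex set. -/

/-! ### Limits, infima and suprema along an ultrafilter -/

open Filter Topology in
theorem Ultrafilter.tendsto_limUnder_of_abs_le {I : Type*} (U : Ultrafilter I) {f : I → ℝ} {C : ℝ}
    (h : ∀ i, |f i| ≤ C) : Tendsto f U (𝓝 (limUnder (U : Filter I) f)) := by
  obtain ⟨l, -, hl⟩ := (isCompact_Icc (a := -C) (b := C)).ultrafilter_le_nhds (U.map f)
    (by
      rw [le_principal_iff]
      exact Eventually.of_forall (f := (U : Filter I)) fun i => abs_le.1 (h i))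
  exact tendsto_nhds_limUnder ⟨l, hl⟩

open Filter Topology in
/-- Infima commute with the limit along an ultrafilter, when the right-hand infimum is taken over
the families of points up to the identification `mk`. -/
theorem Ultrafilter.tendsto_iInf {I β γ : Type*} [Nonempty β] (U : Ultrafilter I)
    {F : I → β → ℝ} {G : γ → ℝ} {mk : (I → β) → γ} (hmk : Function.Surjective mk) {C : ℝ}
    (hF : ∀ i b, |F i b| ≤ C)
    (h : ∀ b : I → β, Tendsto (fun i => F i (b i)) U (𝓝 (G (mk b)))) :
    Tendsto (fun i => ⨅ b, F i b) U (𝓝 (⨅ c, G c)) := by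
  have hbdd : ∀ i, BddBelow (range (F i)) := fun i =>
    ⟨-C, by rintro _ ⟨b, rfl⟩; exact (abs_le.1 (hF i b)).1⟩
  have hlim : Tendsto (fun i => ⨅ b, F i b) U (𝓝 (limUnder (U : Filter I) fun i => ⨅ b, F i b)) := by
    refine U.tendsto_limUnder_of_abs_le (C := C) fun i => abs_le.2 ?_
    exact ⟨le_ciInf fun b => (abs_le.1 (hF i b)).1,
      (ciInf_le (hbdd i) (Classical.arbitrary β)).trans (abs_le.1 (hF i _)).2⟩
  -- The limit exists by compactness, so only its value has to be identified.
  convert hlim using 2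
  set l := limUnder (U : Filter I) fun i => ⨅ b, F i b
  have hle : ∀ c, l ≤ G c := fun c => by
    obtain ⟨b, rfl⟩ := hmk c
    exact le_of_tendsto_of_tendsto' hlim (h b) fun i => ciInf_le (hbdd i) (b i)
  have : Nonempty γ := ⟨mk fun _ => Classical.arbitrary β⟩
  refine le_antisymm (le_of_forall_pos_le_add fun ε hε => ?_) (le_ciInf hle)
  -- Near-minimizers, chosen index by index, form a single family whose class nearly attains the
  -- limit.
  choose b hb using fun i => exists_lt_of_ciInf_lt (lt_add_of_pos_right (⨅ b, F i b) hε)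
  exact (ciInf_le ⟨l, by rintro _ ⟨c, rfl⟩; exact hle c⟩ (mk b)).trans
    (le_of_tendsto_of_tendsto' (h b) (hlim.add_const ε) fun i => (hb i).le)

/-- The real infimum is defined by negating a supremum, so no boundedness is needed: the default
values agree as well. -/
theorem Real.iSup_eq_neg_iInf_neg {ι : Sort*} (g : ι → ℝ) : ⨆ c, g c = -⨅ c, -g c := by
  rw [iInf, Real.sInf_def, neg_neg, iSup]
  congr 1
  ext r
  simp

open Filter Topology in
theorem Ultrafilter.tendsto_iSup {I β γ : Type*} [Nonempty β] (U : Ultrafilter I)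
    {F : I → β → ℝ} {G : γ → ℝ} {mk : (I → β) → γ} (hmk : Function.Surjective mk) {C : ℝ}
    (hF : ∀ i b, |F i b| ≤ C)
    (h : ∀ b : I → β, Tendsto (fun i => F i (b i)) U (𝓝 (G (mk b)))) :
    Tendsto (fun i => ⨆ b, F i b) U (𝓝 (⨆ c, G c)) := by
  simp only [Real.iSup_eq_neg_iInf_neg]
  exact (U.tendsto_iInf (C := C) hmk (fun i b => by simpa using hF i b) fun b => (h b).neg).neg

/-! ### The metric ultrapower and Łoś's theorem -/

noncomputable section

namespace MetricStructure

open MetricLanguage Classical Filter Topology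

variable {L : MetricLanguage.{u, v, w}} {I : Type z}

/-- The families of elements of the sort `s` of `M`, with the limit of distances along `U`. -/
@[nolint unusedArguments]
def UltraPre (M : MetricStructure.{u, v, w, z} L) (_ : Ultrafilter I) (s : L.Srt) : Type z :=
  I → M.carrier s

theorem tendsto_dist (M : MetricStructure.{u, v, w, z} L) (U : Ultrafilter I) {s : L.Srt}
    (a b : I → M.carrier s) : Tendsto (fun i => dist (a i) (b i)) U
      (𝓝 (limUnder (U : Filter I) fun i => dist (a i) (b i))) :=
  U.tendsto_limUnder_of_abs_le (C := L.diam s) fun i => by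
    rw [abs_of_nonneg dist_nonneg]
    exact M.dist_le s _ _

instance (M : MetricStructure.{u, v, w, z} L) (U : Ultrafilter I) (s : L.Srt) :
    PseudoMetricSpace (M.UltraPre U s) where
  dist a b := limUnder (U : Filter I) fun i => dist (a i) (b i)
  dist_self a := by
    refine tendsto_nhds_unique (M.tendsto_dist U a a) ?_
    simp
  dist_comm a b := by
    refine tendsto_nhds_unique (M.tendsto_dist U a b) ?_
    simpa only [dist_comm] using M.tendsto_dist U b a
  dist_triangle a b c := le_of_tendsto_of_tendsto' (M.tendsto_dist U a c)
    ((M.tendsto_dist U a b).add (M.tendsto_dist U b c)) fun _ => dist_triangle _ _ _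

/-- The class of a family of elements of `M` in the sort `s` of the ultrapower. -/
def ultraMk (M : MetricStructure.{u, v, w, z} L) (U : Ultrafilter I) {s : L.Srt}
    (a : I → M.carrier s) : SeparationQuotient (M.UltraPre U s) :=
  SeparationQuotient.mk (X := M.UltraPre U s) a

theorem ultraMk_surjective (M : MetricStructure.{u, v, w, z} L) (U : Ultrafilter I) (s : L.Srt) :
    Function.Surjective (M.ultraMk U (s := s)) :=
  SeparationQuotient.surjective_mk (X := M.UltraPre U s)

theorem tendsto_dist_ultraMk (M : MetricStructure.{u, v, w, z} L) (U : Ultrafilter I) {s : L.Srt}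
    (a b : I → M.carrier s) :
    Tendsto (fun i => dist (a i) (b i)) U (𝓝 (dist (M.ultraMk U a) (M.ultraMk U b))) :=
  M.tendsto_dist U a b

/-- A representative of an element of the ultrapower. -/
def ultraRep (M : MetricStructure.{u, v, w, z} L) (U : Ultrafilter I) {s : L.Srt}
    (c : SeparationQuotient (M.UltraPre U s)) : I → M.carrier s :=
  Function.surjInv (M.ultraMk_surjective U s) c

@[simp] theorem ultraMk_ultraRep (M : MetricStructure.{u, v, w, z} L) (U : Ultrafilter I)
    {s : L.Srt} (c : SeparationQuotient (M.UltraPre U s)) : M.ultraMk U (M.ultraRep U c) = c :=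
  Function.surjInv_eq _ c

/-- Strict inequalities between limits hold eventually, and finitely many can be met at once. Moduli
with a strict hypothesis and a weak conclusion therefore survive the passage to the limit. -/
theorem eventually_dist_lt (M : MetricStructure.{u, v, w, z} L) (U : Ultrafilter I) {n : ℕ}
    {d : Fin n → L.Srt} {a b : ∀ k, I → M.carrier (d k)} {δ : Fin n → ℝ}
    (h : ∀ k, dist (M.ultraMk U (a k)) (M.ultraMk U (b k)) < δ k) :
    ∀ᶠ i in (U : Filter I), ∀ k, dist (a k i) (b k i) < δ k :=
  eventually_all.2 fun k => (M.tendsto_dist_ultraMk U (a k) (b k)).eventually_lt_const (h k)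

theorem tendsto_rel (M : MetricStructure.{u, v, w, z} L) (U : Ultrafilter I) (R : L.Rel)
    (a : ∀ k, I → M.carrier (L.relDom R k)) :
    Tendsto (fun i => M.rel R fun k => a k i) U
      (𝓝 (limUnder (U : Filter I) fun i => M.rel R fun k => a k i)) :=
  U.tendsto_limUnder_of_abs_le (C := max |L.lo R| |L.hi R|) fun _ =>
    abs_le_max_abs_abs (M.rel_mem R _).1 (M.rel_mem R _).2

/-- This serves twice: as the modulus axiom of the ultrapower, and to show that functions do not
depend on representatives. -/
theorem dist_ultraMk_fn_le (M : MetricStructure.{u, v, w, z} L) (U : Ultrafilter I) (f : L.Fn)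
    {ε : ℝ} (hε : 0 < ε) {a b : ∀ k, I → M.carrier (L.fnDom f k)}
    (h : ∀ k, dist (M.ultraMk U (a k)) (M.ultraMk U (b k)) < L.fnModulus f k ε) :
    dist (M.ultraMk U fun i => M.fn f fun k => a k i)
      (M.ultraMk U fun i => M.fn f fun k => b k i) ≤ ε :=
  le_of_tendsto (M.tendsto_dist_ultraMk U _ _)
    ((M.eventually_dist_lt U h).mono fun _ hi => M.fn_modulus f ε hε _ _ hi)

theorem dist_limUnder_rel_le (M : MetricStructure.{u, v, w, z} L) (U : Ultrafilter I) (R : L.Rel)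
    {ε : ℝ} (hε : 0 < ε) {a b : ∀ k, I → M.carrier (L.relDom R k)}
    (h : ∀ k, dist (M.ultraMk U (a k)) (M.ultraMk U (b k)) < L.relModulus R k ε) :
    dist (limUnder (U : Filter I) fun i => M.rel R fun k => a k i)
      (limUnder (U : Filter I) fun i => M.rel R fun k => b k i) ≤ ε :=
  le_of_tendsto ((M.tendsto_rel U R a).dist (M.tendsto_rel U R b))
    ((M.eventually_dist_lt U h).mono fun _ hi => M.rel_modulus R ε hε _ _ hi)

/-- The metric ultrapower of `M` along `U`. -/
def ultrapower (M : MetricStructure.{u, v, w, z} L) (U : Ultrafilter I) :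
    MetricStructure.{u, v, w, z} L where
  carrier s := SeparationQuotient (M.UltraPre U s)
  nonempty _ := ⟨M.ultraMk U fun _ => Classical.arbitrary _⟩
  dist_le s a b := by
    rw [← M.ultraMk_ultraRep U a, ← M.ultraMk_ultraRep U b]
    exact le_of_tendsto' (M.tendsto_dist_ultraMk U _ _) fun _ => M.dist_le s _ _
  -- Chosen representatives are used here; `ultrapower_fn` shows that any others give the same
  -- value.
  fn f a := M.ultraMk U fun i => M.fn f fun k => M.ultraRep U (a k) i
  fn_modulus f ε hε a b h := M.dist_ultraMk_fn_le U f hε fun k => by simpa using h k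
  rel R a := limUnder (U : Filter I) fun i => M.rel R fun k => M.ultraRep U (a k) i
  rel_mem R a := ⟨ge_of_tendsto' (M.tendsto_rel U R _) fun _ => (M.rel_mem R _).1,
    le_of_tendsto' (M.tendsto_rel U R _) fun _ => (M.rel_mem R _).2⟩
  rel_modulus R ε hε a b h := M.dist_limUnder_rel_le U R hε fun k => by simpa using h k

/-- Two representatives of a class are at limit distance `0`, which is below every modulus, so the
values are within every `ε`. -/
theorem ultrapower_fn (M : MetricStructure.{u, v, w, z} L) (U : Ultrafilter I) (f : L.Fn)
    (a : ∀ k, I → M.carrier (L.fnDom f k)) :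
    (M.ultrapower U).fn f (fun k => M.ultraMk U (a k)) =
      M.ultraMk U fun i => M.fn f fun k => a k i := by
  refine eq_of_forall_dist_le fun ε hε => M.dist_ultraMk_fn_le U f hε fun k => ?_
  rw [ultraMk_ultraRep, dist_self]
  exact L.fnModulus_pos f k ε hε

theorem tendsto_rel_ultrapower (M : MetricStructure.{u, v, w, z} L) (U : Ultrafilter I) (R : L.Rel)
    (a : ∀ k, I → M.carrier (L.relDom R k)) :
    Tendsto (fun i => M.rel R fun k => a k i) U
      (𝓝 ((M.ultrapower U).rel R fun k => M.ultraMk U (a k))) := by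
  convert M.tendsto_rel U R a using 2
  refine eq_of_forall_dist_le fun ε hε => M.dist_limUnder_rel_le U R hε fun k => ?_
  rw [ultraMk_ultraRep, dist_self]
  exact L.relModulus_pos R k ε hε

variable {A : L.Srt → Type z}

theorem termVal_ultrapower (M : MetricStructure.{u, v, w, z} L) (U : Ultrafilter I)
    (ρ : ∀ s, A s → M.carrier s) (α : ∀ y : L.Var, I → M.carrier y.1) {s : L.Srt}
    (t : L.Term A s) :
    (M.ultrapower U).termVal (fun s c => M.ultraMk U fun _ => ρ s c)
      (fun y => M.ultraMk U (α y)) t = M.ultraMk U fun i => M.termVal ρ (fun y => α y i) t := by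
  induction t with
  | var y => rfl
  | param c => rfl
  | app f ts ih =>
    simp only [termVal, ih]
    exact M.ultrapower_fn U f _

/-- Łoś's theorem. -/
theorem tendsto_eval_ultrapower (M : MetricStructure.{u, v, w, z} L) (U : Ultrafilter I)
    (ρ : ∀ s, A s → M.carrier s) (φ : L.Formula A) (α : ∀ y : L.Var, I → M.carrier y.1) :
    Tendsto (fun i => M.eval ρ (fun y => α y i) φ) U
      (𝓝 ((M.ultrapower U).eval (fun s c => M.ultraMk U fun _ => ρ s c)
        (fun y => M.ultraMk U (α y)) φ)) := by
  -- Updating a variable by a family commutes both with evaluation at an index and with passing to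
  -- classes.
  have upd : ∀ (α : ∀ y : L.Var, I → M.carrier y.1) (y : L.Var) (b : I → M.carrier y.1),
      (∀ i, (fun y' => Function.update α y b y' i) =
        Function.update (fun y' => α y' i) y (b i)) ∧
      (fun y' => M.ultraMk U (Function.update α y b y')) =
        Function.update (fun y' => M.ultraMk U (α y')) y (M.ultraMk U b) := by
    intro α y b
    refine ⟨fun i => funext fun y' => ?_, funext fun y' => ?_⟩ <;>
    · by_cases h : y' = y
      · subst h; simp
      · simp [Function.update_of_ne h]
  induction φ generalizing α with
  | dist t₁ t₂ =>
    simp only [eval, termVal_ultrapower]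
    exact M.tendsto_dist_ultraMk U _ _
  | rel R ts =>
    simp only [eval, termVal_ultrapower]
    exact M.tendsto_rel_ultrapower U R _
  | conn f hf φs ih =>
    exact (hf.continuous.tendsto _).comp (tendsto_pi_nhds.2 fun k => ih k α)
  | inf y φ ih =>
    obtain ⟨C, hC⟩ := M.exists_bound ρ φ
    -- The induction hypothesis is applied to whole families `b`, whose classes exhaust the sort of
    -- the ultrapower.
    refine U.tendsto_iInf (M.ultraMk_surjective U y.1) (fun i b => hC _) fun b => ?_
    have := ih (Function.update α y b)
    rw [(upd α y b).2] at this
    simp only [(upd α y b).1] at this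
    exact this
  | sup y φ ih =>
    obtain ⟨C, hC⟩ := M.exists_bound ρ φ
    refine U.tendsto_iSup (M.ultraMk_surjective U y.1) (fun i b => hC _) fun b => ?_
    have := ih (Function.update α y b)
    rw [(upd α y b).2] at this
    simp only [(upd α y b).1] at this
    exact this

/-! ### Dependence on the free variables only -/

theorem termVal_congr (N : MetricStructure.{u, v, w, z} L) (ρ : ∀ s, A s → N.carrier s)
    {s : L.Srt} (t : L.Term A s) {α β : N.Assignment} (h : ∀ y ∈ t.vars, α y = β y) :
    N.termVal ρ α t = N.termVal ρ β t := by
  induction t with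
  | var y => exact h y rfl
  | param c => rfl
  | app f ts ih =>
    simp only [termVal]
    congr 1
    exact funext fun k => ih k fun y hy => h y (mem_iUnion.2 ⟨k, hy⟩)

theorem eval_congr (N : MetricStructure.{u, v, w, z} L) (ρ : ∀ s, A s → N.carrier s)
    (φ : L.Formula A) {α β : N.Assignment} (h : ∀ y ∈ φ.freeVars, α y = β y) :
    N.eval ρ α φ = N.eval ρ β φ := by
  have upd : ∀ {y : L.Var} {φ : L.Formula A} {α β : N.Assignment}
      (_ : ∀ y' ∈ φ.freeVars \ {y}, α y' = β y') (b : N.carrier y.1),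
      ∀ y' ∈ φ.freeVars, Function.update α y b y' = Function.update β y b y' := by
    intro y φ α β h b y' hy'
    by_cases hy : y' = y
    · subst hy; simp
    · simpa [Function.update_of_ne hy] using h y' ⟨hy', hy⟩
  induction φ generalizing α β with
  | dist t₁ t₂ =>
    simp only [eval]
    rw [N.termVal_congr ρ t₁ fun y hy => h y (Or.inl hy),
      N.termVal_congr ρ t₂ fun y hy => h y (Or.inr hy)]
  | rel R ts =>
    simp only [eval]
    congr 1
    exact funext fun k => N.termVal_congr ρ _ fun y hy => h y (mem_iUnion.2 ⟨k, hy⟩)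
  | conn f hf φs ih =>
    simp only [eval]
    congr 1
    exact funext fun k => ih k fun y hy => h y (mem_iUnion.2 ⟨k, hy⟩)
  | inf y φ ih => exact iInf_congr fun b => ih (upd h b)
  | sup y φ ih => exact iSup_congr fun b => ih (upd h b)

theorem eval_eq_evalAt (N : MetricStructure.{u, v, w, z} L) (ρ : ∀ s, A s → N.carrier s)
    {x : L.Var} {φ : L.Formula A} (hφ : φ.freeVars ⊆ {x}) (α : N.Assignment) :
    N.eval ρ α φ = N.evalAt ρ x φ (α x) :=
  N.eval_congr ρ φ fun y hy => by
    obtain rfl := hφ hy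
    simp

end MetricStructure
end

/-! ### Krein–Milman in the weak dual -/

/-- The bound `hb` puts `s` inside the dual unit ball, so `s` is compact by Banach–Alaoglu and
Krein–Milman applies. -/
theorem WeakDual.closure_convexHull_extremePoints_of_isClosed {E : Type*} [SeminormedAddCommGroup E]
    [NormedSpace ℝ E] {s : Set (WeakDual ℝ E)} (hs : IsClosed s) (hc : Convex ℝ s)
    (hb : ∀ m ∈ s, ∀ y, |m y| ≤ ‖y‖) : closure (convexHull ℝ (s.extremePoints ℝ)) = s := by
  have : LocallyConvexSpace ℝ (WeakDual ℝ E) :=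
    (LinearMap.weakBilin_withSeminorms (topDualPairing ℝ E)).toLocallyConvexSpace
  refine closure_convexHull_extremePoints ?_ hc
  refine (WeakDual.isCompact_closedBall (𝕜 := ℝ) (0 : StrongDual ℝ E) 1).of_isClosed_subset hs
    fun m hm => ?_
  rw [Set.mem_preimage, mem_closedBall_zero_iff]
  refine ContinuousLinearMap.opNorm_le_bound _ zero_le_one fun P => ?_
  rw [one_mul]
  exact hb m hm P

/-! ### Formulas in elementary extensions -/

noncomputable section

namespace MetricStructure

open MetricLanguage Classical Filter Topology

variable {L : MetricLanguage.{u, v, w}}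

theorem denseRange_toPredicate (M : MetricStructure.{u, v, w, z} L) (x : L.Var) :
    DenseRange fun φ : {φ : L.Formula M.carrier // φ.freeVars ⊆ {x}} =>
      M.toPredicate x φ.1 φ.2 := by
  intro P
  rw [closure_subtype]
  refine closure_mono ?_ (show (P : M.carrier x.1 →ᵇ ℝ) ∈
    closure ((M.formulaAlgebra x : Set (M.carrier x.1 →ᵇ ℝ))) from P.2)
  rintro _ ⟨φ, hφ, rfl⟩
  exact ⟨_, ⟨⟨φ, hφ⟩, rfl⟩, rfl⟩

/-- A lower bound for the values of a formula is preserved by elementary extensions. -/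
theorem IsModelOver.le_evalAt {M N : MetricStructure.{u, v, w, z} L}
    {ρ : ∀ s, M.carrier s → N.carrier s} (h : M.IsModelOver N ρ) {x : L.Var}
    {φ : L.Formula M.carrier} (hφ : φ.freeVars ⊆ {x}) {c : ℝ}
    (hc : ∀ a, c ≤ M.evalAt (fun _ a => a) x φ a) (a : N.carrier x.1) : c ≤ N.evalAt ρ x φ a := by
  -- `IsModelOver` transfers only equations `σ = 0`. The inequality `c ≤ φ` is encoded as one: `min
  -- φ c` is constantly `c` on `M`, so its infimum minus `c` vanishes.
  set ψ : L.Formula M.carrier := .conn (n := 1) (fun y => min (y 0) c)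
    (LipschitzWith.id.min_const c |>.uniformContinuous.comp (Pi.uniformContinuous_proj _ 0)) ![φ]
  have hψ : ψ.freeVars ⊆ {x} := iUnion_subset fun i => by fin_cases i; exact hφ
  set χ : L.Formula M.carrier := .conn (n := 1) (fun y => y 0 - c)
    ((Pi.uniformContinuous_proj _ 0).sub uniformContinuous_const) ![.inf x ψ]
  have hχ : χ ∈ M.theoryOver := by
    refine ⟨?_, fun α => ?_⟩
    · refine iUnion_eq_empty.2 fun i => ?_
      fin_cases i
      exact sdiff_eq_empty.2 hψ
    · have : ∀ b : M.carrier x.1, M.eval (fun _ a => a) (Function.update α x b) ψ = c := fun b => by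
        rw [M.eval_eq_evalAt _ hψ, Function.update_self]
        exact min_eq_right (hc b)
      simp [χ, eval, this]
  set α : N.Assignment := fun _ => Classical.arbitrary _
  have h0 : (⨅ b : N.carrier x.1, N.eval ρ (Function.update α x b) ψ) = c := by
    have := h χ hχ α
    simpa [χ, eval, sub_eq_zero] using this
  obtain ⟨C, hC⟩ := N.exists_bound ρ ψ
  have h1 := ciInf_le (f := fun b : N.carrier x.1 => N.eval ρ (Function.update α x b) ψ)
    ⟨-C, by rintro _ ⟨b, rfl⟩; exact (abs_le.1 (hC _)).1⟩ a
  rw [h0] at h1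
  exact h1.trans (min_le_left _ _)

/-- A formula that defines the product of two given formulas, in two given structures at once. -/
theorem exists_formula_mul (M N : MetricStructure.{u, v, w, z} L)
    (ρ : ∀ s, M.carrier s → N.carrier s) {x : L.Var} {φ ψ : L.Formula M.carrier}
    (hφ : φ.freeVars ⊆ {x}) (hψ : ψ.freeVars ⊆ {x}) :
    ∃ χ : L.Formula M.carrier, χ.freeVars ⊆ {x} ∧
      (∀ a, M.evalAt (fun _ a => a) x χ a =
        M.evalAt (fun _ a => a) x φ a * M.evalAt (fun _ a => a) x ψ a) ∧
      ∀ a, N.evalAt ρ x χ a = N.evalAt ρ x φ a * N.evalAt ρ x ψ a := by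
  obtain ⟨B₁, hB₁⟩ := M.exists_bound (fun _ a => a) φ
  obtain ⟨B₂, hB₂⟩ := M.exists_bound (fun _ a => a) ψ
  obtain ⟨B₃, hB₃⟩ := N.exists_bound ρ φ
  obtain ⟨B₄, hB₄⟩ := N.exists_bound ρ ψ
  -- Multiplication is not uniformly continuous on the plane, so it is truncated at a bound valid in
  -- both structures.
  set B := max (max B₁ B₂) (max B₃ B₄)
  have hle : -B ≤ B := by
    have h1 := (abs_nonneg _).trans (hB₁ fun _ => Classical.arbitrary _)
    have h2 : B₁ ≤ B := (le_max_left _ _).trans (le_max_left _ _)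
    linarith
  have hmul : UniformContinuous fun q : Icc (-B) B × Icc (-B) B => (q.1 : ℝ) * q.2 :=
    CompactSpace.uniformContinuous_of_continuous (by fun_prop)
  have hpr := (LipschitzWith.projIcc hle).uniformContinuous
  refine ⟨.conn (n := 2) (fun y => (projIcc (-B) B hle (y 0) : ℝ) * projIcc (-B) B hle (y 1))
    (hmul.comp ((hpr.comp (Pi.uniformContinuous_proj _ 0)).prodMk
      (hpr.comp (Pi.uniformContinuous_proj _ 1)))) ![φ, ψ], ?_, fun a => ?_, fun a => ?_⟩
  · refine iUnion_subset fun i => ?_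
    fin_cases i
    exacts [hφ, hψ]
  · have h1 := abs_le.1 ((hB₁ (Function.update (fun _ => Classical.arbitrary _) x a)).trans
      ((le_max_left _ _).trans (le_max_left _ _) : B₁ ≤ B))
    have h2 := abs_le.1 ((hB₂ (Function.update (fun _ => Classical.arbitrary _) x a)).trans
      ((le_max_right _ _).trans (le_max_left _ _) : B₂ ≤ B))
    simp [evalAt, eval, projIcc_of_mem hle (mem_Icc.2 h1), projIcc_of_mem hle (mem_Icc.2 h2)]
  · have h1 := abs_le.1 ((hB₃ (Function.update (fun _ => Classical.arbitrary _) x a)).trans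
      ((le_max_left _ _).trans (le_max_right _ _) : B₃ ≤ B))
    have h2 := abs_le.1 ((hB₄ (Function.update (fun _ => Classical.arbitrary _) x a)).trans
      ((le_max_right _ _).trans (le_max_right _ _) : B₄ ≤ B))
    simp [evalAt, eval, projIcc_of_mem hle (mem_Icc.2 h1), projIcc_of_mem hle (mem_Icc.2 h2)]

/-! ### Types are multiplicative means -/

variable {M : MetricStructure.{u, v, w, z} L} {x : L.Var}

theorem map_mul_of_mem_typeSpace {e : WeakDual ℝ (M.definablePredicates x)}
    (he : e ∈ M.typeSpace x) (P Q : M.definablePredicates x) : e (P * Q) = e P * e Q := by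
  obtain ⟨N, ρ, -, a, h⟩ := he
  have hcont : Continuous e := ContinuousLinearMap.continuous e
  refine (M.denseRange_toPredicate x).induction_on₂
    (p := fun P Q => e (P * Q) = e P * e Q) ?_ ?_ P Q
  · exact isClosed_eq (hcont.comp (continuous_fst.mul continuous_snd))
      ((hcont.comp continuous_fst).mul (hcont.comp continuous_snd))
  · rintro ⟨φ, hφ⟩ ⟨ψ, hψ⟩
    obtain ⟨χ, hχ, hM, hN⟩ := M.exists_formula_mul N ρ hφ hψ
    have : M.toPredicate x φ hφ * M.toPredicate x ψ hψ = M.toPredicate x χ hχ := by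
      refine Subtype.ext (BoundedContinuousFunction.ext fun b => ?_)
      exact (hM b).symm
    simp only [this, h _ hφ, h _ hψ, h _ hχ, hN]

theorem typeSpace_subset_meanSpace : M.typeSpace x ⊆ M.meanSpace x := by
  rintro e ⟨N, ρ, hN, a, h⟩
  have hcont : Continuous e := ContinuousLinearMap.continuous e
  refine ⟨fun P hP => le_of_forall_pos_le_add fun ε hε => ?_, ?_⟩
  · obtain ⟨δ, hδ, hd⟩ := Metric.continuous_iff.1 hcont P (ε / 2) (half_pos hε)
    -- `δ` keeps `e` within `ε / 2`, while the other bound makes the formula at least `-(ε / 2)` on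
    -- `M`.
    obtain ⟨⟨φ, hφ⟩, hdist⟩ := (M.denseRange_toPredicate x).exists_dist_lt P
      (lt_min hδ (half_pos hε))
    have h1 := hd _ ((dist_comm _ _).trans_lt (hdist.trans_le (min_le_left _ _)))
    have h2 : -(ε / 2) ≤ e (M.toPredicate x φ hφ) := by
      rw [h _ hφ]
      refine hN.le_evalAt hφ (fun b => ?_) a
      have h3 := (BoundedContinuousFunction.dist_coe_le_dist (f := (P : M.carrier x.1 →ᵇ ℝ))
        (g := M.interp x φ) b).trans_lt
        (show dist (P : M.carrier x.1 →ᵇ ℝ) (M.interp x φ) < _ from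
          hdist.trans_le (min_le_right _ _))
      rw [Real.dist_eq, abs_lt, interp_apply] at h3
      linarith [hP b]
    rw [Real.dist_eq, abs_lt] at h1
    linarith
  · have h0 : (.conn (n := 0) (fun _ => 1) uniformContinuous_const Fin.elim0 :
      L.Formula M.carrier).freeVars ⊆ {x} := by simp [Formula.freeVars]
    have h1 : M.toPredicate x _ h0 = 1 := by
      apply Subtype.ext; ext a; simp [toPredicate, evalAt, eval]
    rw [← h1, h]
    simp [evalAt, eval]

/-! ### Basic properties of means -/

theorem mean_mono {m : WeakDual ℝ (M.definablePredicates x)} (hm : m ∈ M.meanSpace x)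
    {P Q : M.definablePredicates x}
    (h : ∀ a, (P : M.carrier x.1 →ᵇ ℝ) a ≤ (Q : M.carrier x.1 →ᵇ ℝ) a) : m P ≤ m Q := by
  have := hm.1 (Q - P) fun a => sub_nonneg.2 (h a)
  rwa [map_sub m, sub_nonneg] at this

theorem mean_const {m : WeakDual ℝ (M.definablePredicates x)} (hm : m ∈ M.meanSpace x) (c : ℝ) :
    m (c • 1) = c := by
  rw [map_smul m, hm.2, smul_eq_mul, mul_one]

theorem abs_mean_le {m : WeakDual ℝ (M.definablePredicates x)} (hm : m ∈ M.meanSpace x)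
    (P : M.definablePredicates x) : |m P| ≤ ‖P‖ := by
  have hP : ∀ a, |(P : M.carrier x.1 →ᵇ ℝ) a| ≤ ‖P‖ := fun a =>
    BoundedContinuousFunction.norm_coe_le_norm (P : M.carrier x.1 →ᵇ ℝ) a
  have h1 : m P ≤ m (‖P‖ • 1) := mean_mono hm fun a => by simpa using (abs_le.1 (hP a)).2
  have h2 : m ((-‖P‖) • 1) ≤ m P := mean_mono hm fun a => by simpa using (abs_le.1 (hP a)).1
  rw [mean_const hm] at h1 h2
  exact abs_le.2 ⟨h2, h1⟩

theorem convex_meanSpace : Convex ℝ (M.meanSpace x) := by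
  rintro m₁ h₁ m₂ h₂ s t hs ht hst
  refine ⟨fun P hP => ?_, ?_⟩
  · exact add_nonneg (mul_nonneg hs (h₁.1 P hP)) (mul_nonneg ht (h₂.1 P hP))
  · change s * m₁ 1 + t * m₂ 1 = 1
    rw [h₁.2, h₂.2, mul_one, mul_one, hst]

theorem isClosed_meanSpace : IsClosed (M.meanSpace x) := by
  have hev : ∀ P, Continuous fun m : WeakDual ℝ (M.definablePredicates x) => m P :=
    WeakDual.eval_continuous
  have : M.meanSpace x = (⋂ (P : M.definablePredicates x)
      (_ : ∀ a, 0 ≤ (P : M.carrier x.1 →ᵇ ℝ) a), {m | 0 ≤ m P}) ∩ {m | m 1 = 1} := by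
    ext m
    simp only [meanSpace, mem_inter_iff, mem_iInter, mem_ofPred_eq]
  rw [this]
  exact (isClosed_biInter fun P _ => isClosed_le continuous_const (hev P)).inter
    (isClosed_eq (hev 1) continuous_const)

/-- At `c = m P` this is the variance of `P`: nonnegative for a mean, zero for a multiplicative one.
-/
theorem mean_sub_sq (m : WeakDual ℝ (M.definablePredicates x)) (h1 : m 1 = 1) (c : ℝ)
    (P : M.definablePredicates x) :
    m ((P - c • 1) * (P - c • 1)) = m (P * P) - 2 * c * m P + c ^ 2 := by
  have : (P - c • 1) * (P - c • 1) = P * P - (2 * c) • P + (c ^ 2) • 1 := by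
    refine Subtype.ext (BoundedContinuousFunction.ext fun a => ?_)
    simp
    ring
  rw [this, map_add m, map_sub m, map_smul m, map_smul m, h1, smul_eq_mul, smul_eq_mul, mul_one]

theorem sq_mean_le {m : WeakDual ℝ (M.definablePredicates x)} (hm : m ∈ M.meanSpace x)
    (P : M.definablePredicates x) : m P ^ 2 ≤ m (P * P) := by
  have h := hm.1 ((P - m P • 1) * (P - m P • 1)) fun a => mul_self_nonneg _
  rw [mean_sub_sq m hm.2] at h
  linarith

/-! ### Multiplicative means are types -/

/-- A multiplicative mean is the limit of values along an ultrafilter. -/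
theorem exists_ultrafilter_of_map_mul {m : WeakDual ℝ (M.definablePredicates x)}
    (hm : m ∈ M.meanSpace x) (hmul : ∀ P Q, m (P * Q) = m P * m Q) :
    ∃ U : Ultrafilter (M.carrier x.1), ∀ P : M.definablePredicates x,
      Tendsto (P : M.carrier x.1 →ᵇ ℝ) U (𝓝 (m P)) := by
  -- `F` is the coarsest filter along which all nonnegative predicates of mean zero tend to `0`.
  set K : Set (M.definablePredicates x) :=
    {P | m P = 0 ∧ ∀ a, 0 ≤ (P : M.carrier x.1 →ᵇ ℝ) a}
  have : Nonempty K := ⟨⟨0, map_zero m, fun _ => le_rfl⟩⟩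
  set F : Filter (M.carrier x.1) := ⨅ P : K, comap (P.1 : M.carrier x.1 →ᵇ ℝ) (𝓝 0)
  have hF : ∀ P ∈ K, Tendsto (P : M.carrier x.1 →ᵇ ℝ) F (𝓝 0) := fun P hP =>
    tendsto_comap.mono_left (iInf_le _ (⟨P, hP⟩ : K))
  have hne : F.NeBot := by
    refine iInf_neBot_of_directed (fun P Q => ?_) fun P => ?_
    · have hPQ : P.1 + Q.1 ∈ K := by
        refine ⟨?_, fun a => add_nonneg (P.2.2 a) (Q.2.2 a)⟩
        rw [map_add m, P.2.1, Q.2.1, add_zero]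
      refine ⟨⟨P.1 + Q.1, hPQ⟩, ?_, ?_⟩
      · exact tendsto_iff_comap.1 (squeeze_zero P.2.2
          (fun a => le_add_of_nonneg_right (Q.2.2 a)) tendsto_comap)
      · exact tendsto_iff_comap.1 (squeeze_zero Q.2.2
          (fun a => le_add_of_nonneg_left (P.2.2 a)) tendsto_comap)
    · refine comap_neBot_iff.2 fun t ht => ?_
      obtain ⟨ε, hε, hball⟩ := Metric.mem_nhds_iff.1 ht
      -- Otherwise `P ≥ ε` everywhere, and its mean could not be zero.
      by_contra! hcon
      have h := mean_mono hm (P := ε • 1) (Q := P.1) fun a => by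
        have h1 : ¬ |(P.1 : M.carrier x.1 →ᵇ ℝ) a| < ε := fun h =>
          hcon a (hball (by simpa [Real.dist_eq] using h))
        rw [abs_of_nonneg (P.2.2 a), not_lt] at h1
        simpa using h1
      rw [mean_const hm, P.2.1] at h
      exact h.not_gt hε
  refine ⟨Ultrafilter.of F, fun P => ?_⟩
  -- Multiplicativity enters here: the squared deviation has mean zero, so `P` tends to `m P` along
  -- `F`.
  have hK : (P - m P • 1) * (P - m P • 1) ∈ K := by
    refine ⟨?_, fun a => mul_self_nonneg _⟩
    rw [mean_sub_sq m hm.2, hmul]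
    ring
  have h := ((hF _ hK).mono_left (Ultrafilter.of_le F)).sqrt
  rw [Real.sqrt_zero] at h
  refine tendsto_iff_dist_tendsto_zero.2 (h.congr fun a => ?_)
  rw [Real.dist_eq, ← Real.sqrt_mul_self_eq_abs]
  simp

theorem mem_typeSpace_of_map_mul {m : WeakDual ℝ (M.definablePredicates x)}
    (hm : m ∈ M.meanSpace x) (hmul : ∀ P Q, m (P * Q) = m P * m Q) : m ∈ M.typeSpace x := by
  obtain ⟨U, hU⟩ := exists_ultrafilter_of_map_mul hm hmul
  refine ⟨M.ultrapower U, fun s c => M.ultraMk U fun _ => c, fun σ hσ α => ?_,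
    M.ultraMk U id, fun φ hφ => ?_⟩
  · have h := M.tendsto_eval_ultrapower U (fun _ a => a) σ (fun y => M.ultraRep U (α y))
    simp only [hσ.2] at h
    have hα : (fun y => M.ultraMk U (M.ultraRep U (α y))) = α :=
      funext fun y => M.ultraMk_ultraRep U (α y)
    rw [hα] at h
    exact tendsto_nhds_unique h tendsto_const_nhds
  -- The identity family at `x` represents the realizing element; the constant families elsewhere do
  -- not affect the value.
  · set β : ∀ y : L.Var, M.carrier x.1 → M.carrier y.1 :=
      Function.update (fun y _ => Classical.arbitrary _) x id
    have h := M.tendsto_eval_ultrapower U (fun _ a => a) φ β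
    simp only [M.eval_eq_evalAt _ hφ] at h
    have h2 := (M.ultrapower U).eval_eq_evalAt (fun s c => M.ultraMk U fun _ => c) hφ
      (fun y => M.ultraMk U (β y))
    rw [h2] at h
    have hβ : β x = id := Function.update_self ..
    rw [hβ] at h
    exact tendsto_nhds_unique (hU (M.toPredicate x φ hφ)) h

/-! ### Extreme means and multiplicative means -/

/-- With `Q = P - m P`, the zero mean of `Q * Q` is a positive combination of two nonnegative terms,
so both vanish. Then `m₁ Q = 0` by `sq_mean_le`, that is, `m₁ P = m P`. -/
theorem mem_extremePoints_of_map_mul {m : WeakDual ℝ (M.definablePredicates x)}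
    (hm : m ∈ M.meanSpace x) (hmul : ∀ P Q, m (P * Q) = m P * m Q) :
    m ∈ (M.meanSpace x).extremePoints ℝ := by
  refine mem_extremePoints_iff_left.2 ⟨hm, ?_⟩
  rintro m₁ h₁ m₂ h₂ ⟨s, t, hs, ht, -, rfl⟩
  set m := s • m₁ + t • m₂
  refine DFunLike.ext _ _ fun P => ?_
  set Q := P - m P • 1
  have hQ : s * m₁ (Q * Q) + t * m₂ (Q * Q) = 0 := by
    have : m (Q * Q) = 0 := by
      rw [mean_sub_sq m hm.2, hmul]
      ring
    exact this
  have hpos₁ : 0 ≤ m₁ (Q * Q) := h₁.1 _ fun a => mul_self_nonneg _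
  have hpos₂ : 0 ≤ m₂ (Q * Q) := h₂.1 _ fun a => mul_self_nonneg _
  have h0 : m₁ (Q * Q) ≤ 0 := by
    have := mul_nonneg ht.le hpos₂
    exact nonpos_of_mul_nonpos_right (by linarith : s * m₁ (Q * Q) ≤ 0) hs
  have h1 : m₁ Q = 0 := pow_eq_zero_iff two_ne_zero |>.1
    (le_antisymm ((sq_mean_le h₁ Q).trans h0) (sq_nonneg _))
  rwa [map_sub m₁, mean_const h₁, sub_eq_zero] at h1

/-- The functional `P ↦ m (Q * P)`. -/
def meanMul (m : WeakDual ℝ (M.definablePredicates x)) (Q : M.definablePredicates x) :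
    WeakDual ℝ (M.definablePredicates x) :=
  (ContinuousLinearMap.comp m
    ⟨LinearMap.mulLeft ℝ Q, continuous_const.mul continuous_id⟩ :
      M.definablePredicates x →L[ℝ] ℝ)

theorem smul_meanMul_mem_meanSpace {m : WeakDual ℝ (M.definablePredicates x)}
    (hm : m ∈ M.meanSpace x) {Q : M.definablePredicates x}
    (hQ : ∀ a, 0 ≤ (Q : M.carrier x.1 →ᵇ ℝ) a) (h0 : 0 < m Q) :
    (m Q)⁻¹ • meanMul m Q ∈ M.meanSpace x := by
  refine ⟨fun P hP => ?_, ?_⟩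
  · exact mul_nonneg (inv_nonneg.2 h0.le) (hm.1 _ fun a => mul_nonneg (hQ a) (hP a))
  · change (m Q)⁻¹ * m (Q * 1) = 1
    rw [mul_one, inv_mul_cancel₀ h0.ne']

/-- For small `R`, `m` is the average of its reweightings by `1 + R` and `1 - R`, normalized and
weighted by `m (1 + R) / 2` and `m (1 - R) / 2`. Extremality makes the first equal to `m`, which is
multiplicativity at `R`; the general case follows by scaling. -/
theorem map_mul_of_mem_extremePoints {m : WeakDual ℝ (M.definablePredicates x)}
    (hm : m ∈ (M.meanSpace x).extremePoints ℝ) (P Q : M.definablePredicates x) :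
    m (P * Q) = m P * m Q := by
  obtain ⟨hm, hext⟩ := mem_extremePoints_iff_left.1 hm
  -- The bound `1 / 2` keeps both densities at least `1 / 2`, so their means are positive and can be
  -- divided by.
  have key : ∀ R : M.definablePredicates x, (∀ a, |(R : M.carrier x.1 →ᵇ ℝ) a| ≤ 1 / 2) →
      m (R * Q) = m R * m Q := by
    intro R hR
    set R₁ := R + (1 : ℝ) • 1
    set R₂ := (1 : ℝ) • 1 - R
    have hR₁ : ∀ a, 1 / 2 ≤ (R₁ : M.carrier x.1 →ᵇ ℝ) a := fun a => by
      have := (abs_le.1 (hR a)).1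
      simp only [R₁]
      simp
      linarith
    have hR₂ : ∀ a, 1 / 2 ≤ (R₂ : M.carrier x.1 →ᵇ ℝ) a := fun a => by
      have := (abs_le.1 (hR a)).2
      simp only [R₂]
      simp
      linarith
    have hm₁ : 0 < m R₁ := by
      have := mean_mono hm (P := (1 / 2 : ℝ) • 1) (Q := R₁) fun a => by simpa using hR₁ a
      rw [mean_const hm] at this
      linarith
    have hm₂ : 0 < m R₂ := by
      have := mean_mono hm (P := (1 / 2 : ℝ) • 1) (Q := R₂) fun a => by simpa using hR₂ a
      rw [mean_const hm] at this
      linarith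
    have hsum : m R₁ + m R₂ = 2 := by
      rw [map_add m, map_sub m, mean_const hm]
      ring
    have h := hext _ (smul_meanMul_mem_meanSpace hm (fun a => by linarith [hR₁ a]) hm₁) _
      (smul_meanMul_mem_meanSpace hm (fun a => by linarith [hR₂ a]) hm₂)
      ⟨m R₁ / 2, m R₂ / 2, half_pos hm₁, half_pos hm₂, by linarith, by
        refine DFunLike.ext _ _ fun S => ?_
        change m R₁ / 2 * ((m R₁)⁻¹ * m (R₁ * S)) + m R₂ / 2 * ((m R₂)⁻¹ * m (R₂ * S)) = m S
        have : R₁ * S + R₂ * S = (2 : ℝ) • S := by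
          rw [← add_mul, show R₁ + R₂ = (2 : ℝ) • 1 by simp only [R₁, R₂]; module, smul_one_mul]
        have h2 := congrArg m this
        rw [map_add m, map_smul m, smul_eq_mul] at h2
        field_simp
        linarith⟩
    have h2 : (m R₁)⁻¹ * m (R₁ * Q) = m Q := congrArg (fun e => e Q) h
    have h3 : m (R₁ * Q) = m R₁ * m Q := by
      field_simp at h2
      linarith
    rwa [add_mul, smul_one_mul, one_smul, map_add m, map_add m, mean_const hm, add_mul, one_mul,
      add_left_inj] at h3
  -- The summand `1` keeps `c` positive even when `P = 0`.
  set c : ℝ := 2 * (‖P‖ + 1)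
  have hc : 0 < c := by positivity
  have h := key (c⁻¹ • P) fun a => by
    have hP : |(P : M.carrier x.1 →ᵇ ℝ) a| ≤ ‖P‖ :=
      BoundedContinuousFunction.norm_coe_le_norm (P : M.carrier x.1 →ᵇ ℝ) a
    change |c⁻¹ * (P : M.carrier x.1 →ᵇ ℝ) a| ≤ 1 / 2
    rw [abs_mul, abs_of_pos (inv_pos.2 hc), inv_mul_le_iff₀ hc]
    linarith
  rw [smul_mul_assoc, map_smul m, map_smul m, smul_eq_mul, smul_eq_mul, mul_assoc] at h
  exact mul_left_cancel₀ (inv_pos.2 hc).ne' h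

/-! ### The three statements -/

theorem typeSpace_eq_map_mul :
    M.typeSpace x = {m ∈ M.meanSpace x | ∀ P Q, m (P * Q) = m P * m Q} :=
  Subset.antisymm (fun _ he => ⟨typeSpace_subset_meanSpace he, map_mul_of_mem_typeSpace he⟩)
    fun _ hm => mem_typeSpace_of_map_mul hm.1 hm.2

theorem extremePoints_meanSpace : (M.meanSpace x).extremePoints ℝ = M.typeSpace x := by
  rw [typeSpace_eq_map_mul]
  exact Subset.antisymm
    (fun _ hm => ⟨extremePoints_subset hm, map_mul_of_mem_extremePoints hm⟩)
    fun _ hm => mem_extremePoints_of_map_mul hm.1 hm.2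

theorem closure_convexHull_typeSpace :
    closure (convexHull ℝ (M.typeSpace x)) = M.meanSpace x := by
  rw [← extremePoints_meanSpace]
  let : NormedSpace ℝ (M.definablePredicates x) :=
    Submodule.normedSpace (Subalgebra.toSubmodule (M.definablePredicates x))
  exact WeakDual.closure_convexHull_extremePoints_of_isClosed (E := M.definablePredicates x)
    isClosed_meanSpace convex_meanSpace fun _ => abs_mean_le

end MetricStructure
end

theorem mainTheorem8 (L : MetricLanguage.{u, v, w}) (M : MetricStructure.{u, v, w, z} L)
    (x : L.Var) :
    closure (convexHull ℝ (M.typeSpace x)) = M.meanSpace x ∧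
    (M.meanSpace x).extremePoints ℝ = M.typeSpace x ∧
    M.typeSpace x = {m ∈ M.meanSpace x | ∀ P Q, m (P * Q) = m P * m Q} :=
  ⟨MetricStructure.closure_convexHull_typeSpace, MetricStructure.extremePoints_meanSpace,
    MetricStructure.typeSpace_eq_map_mul⟩
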